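/- For $t \in \mathbf{Q}^{\times}$ let $E_t^{-4}$ be the elliptic curve over $\mathbf{Q}$ with Weierstrass equation $y^2 = x^3 - tx$, and let $a_p(E_t^{-4})$ be its $p$-th Fourier coefficient (so $a_p(E_t^{-4}) = p + 1 - \#\tilde E_t^{-4}(\mathbf{F}_p)$ at a prime $p$ of good reduction, $\tilde E_t^{-4}$ being the reduction modulo $p$). For an irreducible $\pi \in \mathbf{Z}[i]$ of odd norm $N\pi$ and $\alpha \in \mathbf{Z}[i]$ prime to $\pi$, let $\left(\frac{\alpha}{\pi}\right)_4 \in \{\pm 1, \pm i\}$ be the quartic residue symbol, characterized by $\left(\frac{\alpha}{\pi}\right)_4 \equiv \alpha^{(N\pi - 1)/4} \pmod{\pi}$, and extend it multiplicatively to rational numbers $\alpha$ whose numerator and denominator are prime to $\pi$. An element $\alpha \in \mathbf{Z}[i]$ is called primary if $\alpha \equiv 1 \pmod{2+2i}$. **Proposition 4.3.** Let $t \in \mathbf{Q}^{\times}$, let $p \equiv 1 \pmod 4$ be a prime relatively prime to $t$ (that is, dividing neither the numerator nor the denominator of $t$), and let $a+bi$ be a primary irreducible of $\mathbf{Z}[i]$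 of norm $p$. Then $a_p(E_t^{-4})$ is not divisible by $a+bi$, and $$\left(\frac{a_p(E_t^{-4})}{a+bi}\right)_4 = i^{\frac{a-1}{2}} \cdot (-1)^{\frac{b^2+2b}{8}} \cdot \left(\frac{t}{a+bi}\right)_4^{\frac{p-1}{4}}.$$ -/

import Mathlib

/-- The elliptic curve `E_t^{-4} : y² = x³ - t x` over `ℚ` (elliptic for `t ≠ 0`). -/
def curveE (t : ℚ) : WeierstrassCurve ℚ :=
  { a₁ := 0, a₂ := 0, a₃ := 0, a₄ := -t, a₆ := 0 }

/-- The `p`-th Fourier coefficient `a_p(E)` of an elliptic curve `E` over `ℚ`. The Euler factor of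
`E` at `p` is `1 - a_p T + p T²` for good reduction and `1 - a_p T` for bad reduction, so `a_p` is
minus the coefficient of `T` in Mathlib's local polynomial, which is defined through a minimal
Weierstrass equation of `E` over `ℤ_p`. For good reduction this is `a_p = p + 1 - #E(𝔽_p)`. -/
noncomputable def ellipticFourierCoeff (E : WeierstrassCurve ℚ) (p : ℕ) [Fact p.Prime] : ℤ :=
  -((E.baseChange ℚ_[p]).localPolynomial ℤ_[p]).coeff 1

/-- The imaginary unit, as a unit of `ℤ[i]`. -/
def unitI : GaussianIntˣ where
  val := ⟨0, 1⟩
  inv := ⟨0, -1⟩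
  val_inv := by decide
  inv_val := by decide

/-- A Gaussian integer `α` is primary if `α ≡ 1 mod 2 + 2i`. -/
def IsPrimary (α : GaussianInt) : Prop :=
  (⟨2, 2⟩ : GaussianInt) ∣ α - 1

open Classical in
/-- The quartic residue symbol `(α/π)₄` for a prime `π` of `ℤ[i]` not dividing `2`: if `π ∤ α`, it is
the unique fourth root of unity `ζ` with `α ^ ((N π - 1) / 4) ≡ ζ mod π`.
If `π ∣ α`, there is no such `ζ` and the value is `0`. -/
noncomputable def quarticSymbol (α π : GaussianInt) : GaussianInt :=
  if h : ∃ ζ : GaussianInt, ζ ^ 4 = 1 ∧ π ∣ α ^ ((π.norm.natAbs - 1) / 4) - ζ then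
    h.choose
  else 0

/-- The quartic residue symbol `(t/π)₄` of a rational number `t` prime to `π`, extended from integers
by multiplicativity: `(m/n / π)₄ = (m/π)₄ (n/π)₄⁻¹`. The inverse of a fourth root of unity is its
conjugate. -/
noncomputable def quarticSymbolRat (t : ℚ) (π : GaussianInt) : GaussianInt :=
  quarticSymbol (t.num : GaussianInt) π * star (quarticSymbol (t.den : GaussianInt) π)

/-! Let π = a + bi, let χ be the quartic character mod π and J = J(χ, χ²). Counting points gives a_p
= -(χ(t)³ J + χ(t) J̄) (`IsQuarticChar.sum_quadraticChar`). Here J = -π: π divides J, |J|² = p, and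
J ≡ -1 mod 2 + 2i fixes the remaining unit because π is primary (`IsQuarticChar.jacobiSum_eq`).
Hence a_p ≡ 2a·t^((p-1)/4) mod π, and applying χ leaves only χ(2a) to compute.

For χ(a), take a prime q ∣ a. The Gauss sum satisfies g(χ)⁴ = pJ²; in characteristic q, p = b² and π
= bi, so g(χ)⁴ = -b⁴, and Frobenius then yields χ(q) (`IsQuarticChar.apply_prime_of_dvd_re`). For
χ(2), use 2a²i ≡ (a+b)² mod π and evaluate the quadratic symbol of a+b by reciprocity
(`legendreSym_re_add_im`). Combining the two is a finite check on a, b mod 8.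

The coefficient is defined through a minimal equation over ℤ_p; since p ≥ 5, any integral equation
with unit discriminant computes it (`ellipticFourierCoeff_eq`). -/

lemma GaussianInt.eq_of_pow_four_eq_one {z : GaussianInt} (hz : z ^ 4 = 1) :
    z = 1 ∨ z = -1 ∨ z = ⟨0, 1⟩ ∨ z = -⟨0, 1⟩ := by
  have h : (z - 1) * ((z - -1) * ((z - ⟨0, 1⟩) * (z - -⟨0, 1⟩))) = 0 := by
    have hI : (⟨0, 1⟩ : GaussianInt) ^ 2 = -1 := by decide
    linear_combination hz - (z ^ 2 - 1) * hI
  simpa only [mul_eq_zero, sub_eq_zero] using h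

lemma GaussianInt.pow_three_eq_star {z : GaussianInt} (hz : z ^ 4 = 1) : z ^ 3 = star z := by
  rcases eq_of_pow_four_eq_one hz with rfl | rfl | rfl | rfl <;> decide

/-! ### Residue map of a Gaussian prime and its quartic character -/

section ResidueHom

variable {p : ℕ} [Fact p.Prime]

lemma GaussianInt.ringHom_I_sq {R : Type*} [CommRing R] (ρ : GaussianInt →+* R) : ρ ⟨0, 1⟩ ^ 2 = -1 := by
  rw [← map_pow, show (⟨0, 1⟩ : GaussianInt) ^ 2 = -1 by decide, map_neg, map_one]

lemma two_ne_zero_of_mod_four (hp4 : p % 4 = 1) : (2 : ZMod p) ≠ 0 := by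
  intro h
  have h' : ((2 : ℕ) : ZMod p) = 0 := by exact_mod_cast h
  rw [ZMod.natCast_eq_zero_iff] at h'
  have := Nat.le_of_dvd two_pos h'
  have := (Fact.out : p.Prime).two_le
  interval_cases p
  omega

/-- If ±1 or ±i were identified in `R`, then 2 = 0 would follow. Identities between values of χ can
thus be checked modulo π or in characteristic q. -/
lemma GaussianInt.eq_of_ringHom_eq {R : Type*} [CommRing R] (h2 : (2 : R) ≠ 0)
    (ρ : GaussianInt →+* R) {z w : GaussianInt} (hz : z ^ 4 = 1) (hw : w ^ 4 = 1) (h : ρ z = ρ w) : z = w := by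
  have hI := ringHom_I_sq ρ
  have hone : ρ (z * w ^ 3) = 1 := by
    rw [map_mul, map_pow, h, ← map_pow, ← map_mul, ← pow_succ', hw, map_one]
  have key : z * w ^ 3 = 1 := by
    have h4 : (z * w ^ 3) ^ 4 = 1 := by
      rw [mul_pow, hz, ← pow_mul, mul_comm 3 4, pow_mul, hw, one_pow, one_mul]
    rcases eq_of_pow_four_eq_one h4 with h | h | h | h
    · exact h
    all_goals
      rw [h] at hone
      exfalso; apply h2
      try simp only [map_neg, map_one] at hone
    · linear_combination -hone
    · rw [hone] at hI; linear_combination hI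
    · linear_combination hI + (ρ ⟨0, 1⟩ - 1) * hone
  linear_combination w * key - z * hw

/-- Send i to -a/b. The kernel is proper and contains the maximal ideal generated by a + bi, so it
equals that ideal. -/
lemma GaussianInt.exists_residueHom {a b : ℤ} (hirr : Irreducible (⟨a, b⟩ : GaussianInt))
    (hnorm : Zsqrtd.norm (⟨a, b⟩ : GaussianInt) = p) :
    ∃ ρ : GaussianInt →+* ZMod p, ∀ z, ρ z = 0 ↔ (⟨a, b⟩ : GaussianInt) ∣ z := by
  have hab : a ^ 2 + b ^ 2 = (p : ℤ) := by
    rw [← hnorm, Zsqrtd.norm_def]; ring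
  have habp : (a : ZMod p) ^ 2 + (b : ZMod p) ^ 2 = 0 := by
    have := congrArg (Int.cast : ℤ → ZMod p) hab
    simpa using this
  have hb : (b : ZMod p) ≠ 0 := by
    intro hb
    have ha : (a : ZMod p) = 0 := by simpa [hb] using habp
    rw [ZMod.intCast_zmod_eq_zero_iff_dvd] at ha hb
    obtain ⟨x, rfl⟩ := ha
    obtain ⟨y, rfl⟩ := hb
    have hp := (Fact.out : p.Prime)
    have : (p : ℤ) * (x ^ 2 + y ^ 2) = 1 := by
      have hp0 : (p : ℤ) ≠ 0 := by exact_mod_cast hp.ne_zero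
      apply mul_left_cancel₀ hp0
      linear_combination hab
    have := Int.isUnit_iff.1 (IsUnit.of_mul_eq_one _ this)
    have := hp.two_le
    omega
  let ρ : GaussianInt →+* ZMod p := Zsqrtd.lift ⟨-(a : ZMod p) / b, by
    field_simp
    push_cast
    linear_combination habp⟩
  have hρ : ρ ⟨a, b⟩ = 0 := by
    change (a : ZMod p) + b * (-(a : ZMod p) / b) = 0
    field_simp; ring
  have hmax := PrincipalIdealRing.isMaximal_of_irreducible hirr
  have hker : RingHom.ker ρ = Ideal.span {(⟨a, b⟩ : GaussianInt)} := by
    refine (hmax.eq_of_le (RingHom.ker_ne_top ρ) ?_).symm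
    rw [Ideal.span_singleton_le_iff_mem]
    exact hρ
  exact ⟨ρ, fun z => by rw [← RingHom.mem_ker, hker, Ideal.mem_span_singleton]⟩

/-- `χ` is the quartic residue character of `ZMod p` attached to the residue map `ρ` of a Gaussian
prime above `p`. -/
structure IsQuarticChar (ρ : GaussianInt →+* ZMod p) (χ : MulChar (ZMod p) GaussianInt) : Prop where
  map_apply : ∀ x, ρ (χ x) = x ^ ((p - 1) / 4)
  pow_four : ∀ x, x ≠ 0 → χ x ^ 4 = 1

lemma exists_pow_four_eq_one_ringHom_eq (hp4 : p % 4 = 1) (ρ : GaussianInt →+* ZMod p)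
    {x : ZMod p} (hx : x ≠ 0) : ∃ z : GaussianInt, z ^ 4 = 1 ∧ ρ z = x ^ ((p - 1) / 4) := by
  have hI := GaussianInt.ringHom_I_sq ρ
  have h4 : (x ^ ((p - 1) / 4)) ^ 4 = 1 := by
    rw [← pow_mul, show (p - 1) / 4 * 4 = p - 1 by omega, ZMod.pow_card_sub_one_eq_one hx]
  generalize x ^ ((p - 1) / 4) = y at h4
  have h : (y - 1) * ((y - -1) * ((y - ρ ⟨0, 1⟩) * (y - -ρ ⟨0, 1⟩))) = 0 := by
    linear_combination h4 - (y ^ 2 - 1) * hI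
  simp only [mul_eq_zero, sub_eq_zero] at h
  rcases h with rfl | rfl | rfl | rfl
  · exact ⟨1, by decide, by simp⟩
  · exact ⟨-1, by decide, by simp⟩
  · exact ⟨⟨0, 1⟩, by decide, rfl⟩
  · exact ⟨-⟨0, 1⟩, by decide, by simp⟩

open Classical in
lemma exists_isQuarticChar (hp4 : p % 4 = 1) (ρ : GaussianInt →+* ZMod p) :
    ∃ χ : MulChar (ZMod p) GaussianInt, IsQuarticChar ρ χ := by
  choose f hf4 hfρ using fun x : ZMod p => fun hx : x ≠ 0 =>
    exists_pow_four_eq_one_ringHom_eq hp4 ρ hx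
  have hm : (p - 1) / 4 ≠ 0 := by have := (Fact.out : p.Prime).two_le; omega
  refine ⟨⟨⟨⟨fun x => if hx : x = 0 then 0 else f x hx, ?_⟩, ?_⟩, ?_⟩, ?_, ?_⟩
  · rw [dif_neg one_ne_zero]
    exact GaussianInt.eq_of_ringHom_eq (two_ne_zero_of_mod_four hp4) ρ (hf4 _ _) (one_pow _) (by rw [hfρ]; simp)
  · intro x y
    dsimp only
    by_cases hx : x = 0
    · simp [hx]
    by_cases hy : y = 0
    · simp [hy]
    rw [dif_neg hx, dif_neg hy, dif_neg (mul_ne_zero hx hy)]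
    refine GaussianInt.eq_of_ringHom_eq (two_ne_zero_of_mod_four hp4) ρ (hf4 _ _) ?_ ?_
    · rw [mul_pow, hf4, hf4, one_mul]
    · rw [map_mul, hfρ, hfρ, hfρ, mul_pow]
  · intro x hx
    have : x = 0 := by simpa using hx
    simp [this]
  · intro x
    change ρ (if hx : x = 0 then 0 else f x hx) = _
    split_ifs with hx
    · simp [hx, hm]
    · exact hfρ x hx
  · intro x hx
    change (if hx : x = 0 then 0 else f x hx) ^ 4 = _
    rw [dif_neg hx, hf4]

variable {ρ : GaussianInt →+* ZMod p} {χ : MulChar (ZMod p) GaussianInt}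

lemma IsQuarticChar.eq_of_map_eq (hχ : IsQuarticChar ρ χ) (hp4 : p % 4 = 1) {x : ZMod p}
    (hx : x ≠ 0) {z : GaussianInt} (hz : z ^ 4 = 1) (h : ρ z = x ^ ((p - 1) / 4)) : χ x = z :=
  GaussianInt.eq_of_ringHom_eq (two_ne_zero_of_mod_four hp4) ρ (hχ.pow_four x hx) hz (by rw [hχ.map_apply, h])

lemma IsQuarticChar.apply_map (hχ : IsQuarticChar ρ χ) (hp4 : p % 4 = 1) {z : GaussianInt}
    (hz : z ^ 4 = 1) : χ (ρ z) = z ^ ((p - 1) / 4) := by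
  refine hχ.eq_of_map_eq hp4 ?_ ?_ (map_pow _ _ _)
  · intro h
    have := congrArg ρ hz
    rw [map_pow, h, map_one] at this
    simp at this
  · rw [← pow_mul, mul_comm, pow_mul, hz, one_pow]

/-- The default value 0 of the symbol matches χ(0) = 0, so no coprimality is needed. -/
lemma quarticSymbol_eq (hχ : IsQuarticChar ρ χ) (hp4 : p % 4 = 1) {π : GaussianInt}
    (hnorm : π.norm = p) (hρ : ∀ z, ρ z = 0 ↔ π ∣ z) (α : GaussianInt) :
    quarticSymbol α π = χ (ρ α) := by
  have hm : (p - 1) / 4 ≠ 0 := by have := (Fact.out : p.Prime).two_le; omega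
  have hN : π.norm.natAbs = p := by rw [hnorm]; rfl
  have hiff (ζ : GaussianInt) :
      π ∣ α ^ ((π.norm.natAbs - 1) / 4) - ζ ↔ ρ ζ = ρ α ^ ((p - 1) / 4) := by
    rw [← hρ, hN, map_sub, map_pow, sub_eq_zero, eq_comm]
  unfold quarticSymbol
  by_cases h0 : ρ α = 0
  · rw [h0, MulChar.map_zero]
    refine dif_neg ?_
    rintro ⟨ζ, h4, h⟩
    rw [hiff, h0] at h
    rw [zero_pow hm] at h
    have := congrArg ρ h4
    rw [map_pow, h, map_one] at this
    simp at this
  · have hex : ∃ ζ : GaussianInt, ζ ^ 4 = 1 ∧ π ∣ α ^ ((π.norm.natAbs - 1) / 4) - ζ := by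
      simpa only [hiff] using exists_pow_four_eq_one_ringHom_eq hp4 ρ h0
    rw [dif_pos hex]
    exact (hχ.eq_of_map_eq hp4 h0 hex.choose_spec.1 ((hiff _).1 hex.choose_spec.2)).symm

end ResidueHom

/-! ### The Jacobi sum J(χ, χ²) -/

section QuarticJacobi

open Finset

variable {p : ℕ} [Fact p.Prime] {ρ : GaussianInt →+* ZMod p} {χ : MulChar (ZMod p) GaussianInt}

lemma ringChar_zmod_ne_two (hp4 : p % 4 = 1) : ringChar (ZMod p) ≠ 2 := by
  rw [ZMod.ringChar_zmod_n]; omega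

lemma IsQuarticChar.sq_apply (hχ : IsQuarticChar ρ χ) (hp4 : p % 4 = 1) (x : ZMod p) :
    χ x ^ 2 = ((quadraticChar (ZMod p) x : ℤ) : GaussianInt) := by
  by_cases hx : x = 0
  · simp [hx, χ.map_zero]
  have h2 := ringChar_zmod_ne_two hp4
  refine GaussianInt.eq_of_ringHom_eq (two_ne_zero_of_mod_four hp4) ρ ?_ ?_ ?_
  · rw [← pow_mul, mul_comm, pow_mul, hχ.pow_four x hx, one_pow]
  · rw [show 4 = 2 * 2 from rfl, pow_mul, ← Int.cast_pow, quadraticChar_sq_one hx]; simp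
  · rw [map_pow, hχ.map_apply, map_intCast, quadraticChar_eq_pow_of_char_ne_two' h2, ← pow_mul,
      ZMod.card]
    congr 1; omega

lemma IsQuarticChar.exists_sq_eq_neg_one (hχ : IsQuarticChar ρ χ) (hp4 : p % 4 = 1) :
    ∃ x, x ≠ 0 ∧ χ x ^ 2 = -1 := by
  obtain ⟨x, hx⟩ := quadraticChar_exists_neg_one' (ringChar_zmod_ne_two (p := p) hp4)
  refine ⟨x, x.ne_zero, ?_⟩
  rw [hχ.sq_apply hp4, hx]; simp

lemma IsQuarticChar.ringHomComp_sq_ne_one (hχ : IsQuarticChar ρ χ) (hp4 : p % 4 = 1)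
    {R : Type*} [CommRing R] (f : GaussianInt →+* R) (h2 : (2 : R) ≠ 0) :
    (χ.ringHomComp f) ^ 2 ≠ 1 := by
  intro h
  obtain ⟨x, hx, hx2⟩ := hχ.exists_sq_eq_neg_one hp4
  have h1 : ((χ.ringHomComp f) ^ 2) x = 1 := by
    rw [h]; exact MulChar.one_apply (isUnit_iff_ne_zero.2 hx)
  rw [MulChar.pow_apply' _ two_ne_zero, MulChar.ringHomComp_apply, ← map_pow, hx2, map_neg,
    map_one] at h1
  apply h2
  linear_combination -h1

lemma IsQuarticChar.pow_four_eq_one (hχ : IsQuarticChar ρ χ) : χ ^ 4 = 1 := by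
  refine MulChar.ext fun x => ?_
  rw [MulChar.pow_apply_coe, hχ.pow_four _ x.ne_zero, MulChar.one_apply_coe]

lemma IsQuarticChar.pow_three_apply (hχ : IsQuarticChar ρ χ) (x : ZMod p) :
    χ x ^ 3 = star (χ x) := by
  by_cases hx : x = 0
  · simp [hx, χ.map_zero]
  · exact GaussianInt.pow_three_eq_star (hχ.pow_four x hx)

lemma sum_eval_eq_zero_of_natDegree_lt {K : Type*} [Field K] [Fintype K] (P : Polynomial K)
    (hP : P.natDegree < Fintype.card K - 1) : ∑ x, P.eval x = 0 := by
  simp only [Polynomial.eval_eq_sum_range]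
  rw [sum_comm]
  refine sum_eq_zero fun i hi => ?_
  rw [← mul_sum, FiniteField.sum_pow_lt_card_sub_one K i (by rw [mem_range] at hi; omega), mul_zero]

/-- Modulo π the sum becomes ∑ x^m (1-x)^(2m) with m = (p-1)/4; its degree 3m is below p - 1, so it
vanishes. -/
lemma IsQuarticChar.map_jacobiSum (hχ : IsQuarticChar ρ χ) (hp4 : p % 4 = 1) :
    ρ (jacobiSum χ (χ ^ 2)) = 0 := by
  have hp := (Fact.out : p.Prime).two_le
  have := sum_eval_eq_zero_of_natDegree_lt (K := ZMod p)
    (Polynomial.X ^ ((p - 1) / 4) * (1 - Polynomial.X) ^ ((p - 1) / 4 * 2)) (by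
      rw [ZMod.card]
      refine lt_of_le_of_lt (b := (p - 1) / 4 + (p - 1) / 4 * 2) ?_ (by omega)
      compute_degree)
  rw [← this, jacobiSum, map_sum]
  refine sum_congr rfl fun x _ => ?_
  rw [MulChar.pow_apply' _ two_ne_zero, map_mul, map_pow, hχ.map_apply, hχ.map_apply, ← pow_mul]
  simp

lemma dvd_sub_one_mul_sub_one {z w : GaussianInt} (hz : z ^ 4 = 1) (hw : w = 1 ∨ w = -1) :
    (⟨2, 2⟩ : GaussianInt) ∣ (z - 1) * (w - 1) := by
  rcases hw with rfl | rfl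
  · simp
  rcases GaussianInt.eq_of_pow_four_eq_one hz with rfl | rfl | rfl | rfl
  · simp
  · exact ⟨⟨1, -1⟩, by decide⟩
  · exact ⟨⟨0, -1⟩, by decide⟩
  · exact ⟨1, by decide⟩

/-- Expanding ∑ (χ(x) - 1)(χ²(1-x) - 1) gives J + p. Every term is divisible by 2 + 2i, those at x =
0, 1 being zero, and p ≡ 1 mod 4. -/
lemma IsQuarticChar.dvd_jacobiSum_add_one (hχ : IsQuarticChar ρ χ) (hp4 : p % 4 = 1) :
    (⟨2, 2⟩ : GaussianInt) ∣ jacobiSum χ (χ ^ 2) + 1 := by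
  have h2 : (χ ^ 2) ≠ 1 := hχ.ringHomComp_sq_ne_one hp4 (RingHom.id _) (by decide)
  have h1 : χ ≠ 1 := by rintro rfl; simp at h2
  have key : ∑ x, (χ x - 1) * ((χ ^ 2) (1 - x) - 1) = jacobiSum χ (χ ^ 2) + p := by
    have e : ∑ x : ZMod p, (χ ^ 2) (1 - x) = 0 := by
      rw [← MulChar.sum_eq_zero_of_ne_one h2]
      exact (Equiv.subLeft (1 : ZMod p)).sum_comp (fun x => (χ ^ 2) x)
    have : ∀ x, (χ x - 1) * ((χ ^ 2) (1 - x) - 1) =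
        χ x * (χ ^ 2) (1 - x) - χ x - (χ ^ 2) (1 - x) + 1 := fun x => by ring
    simp only [this, sum_add_distrib, sum_sub_distrib, MulChar.sum_eq_zero_of_ne_one h1, e,
      jacobiSum]
    simp
  have hdvd : (⟨2, 2⟩ : GaussianInt) ∣ jacobiSum χ (χ ^ 2) + p := by
    rw [← key]
    refine dvd_sum fun x _ => ?_
    by_cases hx0 : x = 0
    · simp [hx0]
    by_cases hx1 : x = 1
    · simp [hx1]
    refine dvd_sub_one_mul_sub_one (hχ.pow_four x hx0) ?_
    rw [MulChar.pow_apply' _ two_ne_zero, hχ.sq_apply hp4]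
    rcases quadraticChar_dichotomy (sub_ne_zero.2 (Ne.symm hx1)) with h | h <;> simp [h]
  have hp : (⟨2, 2⟩ : GaussianInt) ∣ (p : GaussianInt) - 1 := by
    obtain ⟨k, hk⟩ : ∃ k, p = 4 * k + 1 := ⟨p / 4, by omega⟩
    refine ⟨⟨1, -1⟩ * k, ?_⟩
    rw [hk, ← mul_assoc, show (⟨2, 2⟩ : GaussianInt) * ⟨1, -1⟩ = 4 by decide]
    push_cast; ring
  have := dvd_sub hdvd hp
  rwa [show jacobiSum χ (χ ^ 2) + p - ((p : GaussianInt) - 1) = jacobiSum χ (χ ^ 2) + 1 by ring]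
    at this

lemma IsQuarticChar.star_jacobiSum (hχ : IsQuarticChar ρ χ) :
    star (jacobiSum χ (χ ^ 2)) = jacobiSum (χ ^ 3) (χ ^ 2) := by
  rw [jacobiSum, ← starRingEnd_apply, map_sum, jacobiSum]
  refine sum_congr rfl fun x _ => ?_
  rw [map_mul, starRingEnd_apply, starRingEnd_apply, MulChar.pow_apply' _ two_ne_zero,
    MulChar.pow_apply' _ three_ne_zero, star_pow, ← hχ.pow_three_apply, ← hχ.pow_three_apply]
  congr 1
  by_cases hx : 1 - x = 0
  · simp [hx, χ.map_zero]
  · linear_combination χ (1 - x) ^ 2 * hχ.pow_four _ hx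

/-- This is |J|² = p, valid because χ, χ² and χ³ are nontrivial; the product formula is applied in
ℂ. -/
lemma IsQuarticChar.jacobiSum_mul_star (hχ : IsQuarticChar ρ χ) (hp4 : p % 4 = 1) :
    jacobiSum χ (χ ^ 2) * star (jacobiSum χ (χ ^ 2)) = p := by
  have hinj : Function.Injective GaussianInt.toComplex := fun x y h => GaussianInt.toComplex_inj.1 h
  have h2 : χ.ringHomComp GaussianInt.toComplex ^ 2 ≠ 1 :=
    hχ.ringHomComp_sq_ne_one hp4 _ two_ne_zero
  have h4 : χ.ringHomComp GaussianInt.toComplex ^ 4 = 1 := by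
    rw [MulChar.ringHomComp_pow, hχ.pow_four_eq_one, MulChar.ringHomComp_one]
  have hinv : (χ.ringHomComp GaussianInt.toComplex)⁻¹ = χ.ringHomComp GaussianInt.toComplex ^ 3 :=
    inv_eq_of_mul_eq_one_right (by rw [← pow_succ', h4])
  have hinv2 : (χ.ringHomComp GaussianInt.toComplex ^ 2)⁻¹ =
      χ.ringHomComp GaussianInt.toComplex ^ 2 :=
    inv_eq_of_mul_eq_one_right (by rw [← pow_add, h4])
  have h := jacobiSum_mul_jacobiSum_inv (F := ZMod p) (F' := ℂ)
    (χ := χ.ringHomComp GaussianInt.toComplex) (φ := χ.ringHomComp GaussianInt.toComplex ^ 2)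
    (by rw [ringChar.eq_zero, ZMod.ringChar_zmod_n]; exact (Fact.out : p.Prime).ne_zero.symm)
    (by intro h; exact h2 (by rw [h, one_pow])) h2
    (by
      intro h; apply h2
      have h3 : χ.ringHomComp GaussianInt.toComplex ^ 3 = 1 := by rw [← h, ← pow_succ']
      rw [pow_succ, h3, one_mul] at h4
      rw [h4, one_pow])
  rw [hinv, hinv2, MulChar.ringHomComp_pow, MulChar.ringHomComp_pow, jacobiSum_ringHomComp,
    jacobiSum_ringHomComp, ZMod.card, ← hχ.star_jacobiSum, ← map_mul] at h
  apply hinj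
  rw [h, map_natCast]

lemma IsQuarticChar.jacobiSum_eq (hχ : IsQuarticChar ρ χ) (hp4 : p % 4 = 1) {π : GaussianInt}
    (hnorm : π.norm = p) (hρ : ∀ z, ρ z = 0 ↔ π ∣ z) (hprimary : IsPrimary π) :
    jacobiSum χ (χ ^ 2) = -π := by
  obtain ⟨w, hw⟩ := (hρ _).1 (hχ.map_jacobiSum hp4)
  have hJ := hχ.jacobiSum_mul_star hp4
  have hππ : π * star π = p := by
    have := Zsqrtd.norm_eq_mul_conj π
    rw [← this, hnorm]; simp
  have hp0 : (p : GaussianInt) ≠ 0 := by exact_mod_cast (Fact.out : p.Prime).ne_zero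
  have hww : w * star w = 1 := by
    apply mul_left_cancel₀ hp0
    rw [hw, star_mul] at hJ
    linear_combination hJ - w * star w * hππ
  obtain ⟨v, hv⟩ : (⟨2, 2⟩ : GaussianInt) ∣ w + 1 := by
    have := dvd_sub (hχ.dvd_jacobiSum_add_one hp4) (hprimary.mul_right w)
    rw [hw] at this
    convert this using 1
    ring
  have hnw : w.norm = 1 := by
    have := Zsqrtd.norm_eq_mul_conj w
    rw [hww] at this
    exact_mod_cast this
  -- The norm of w + 1 is 2 + 2 re w, and N(2 + 2i) = 8 divides it; with |re w| ≤ 1 this forces re w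
  -- = -1.
  have h8 : (w + 1).norm = 8 * v.norm := by
    rw [hv, Zsqrtd.norm_mul]; rfl
  rw [Zsqrtd.norm_def] at hnw h8
  simp only [Zsqrtd.re_add, Zsqrtd.im_add, Zsqrtd.re_one, Zsqrtd.im_one] at h8
  have hx : w.re ≤ 1 := by nlinarith [sq_nonneg w.im, sq_nonneg w.re]
  have hx' : -1 ≤ w.re := by nlinarith [sq_nonneg w.im, sq_nonneg w.re]
  have hre : w.re = -1 := by
    have : 2 + 2 * w.re = 8 * v.norm := by linear_combination h8 - hnw
    omega
  have him : w.im = 0 := by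
    rw [hre] at hnw
    have : w.im * w.im = 0 := by linarith
    simpa using this
  have : w = -1 := by
    ext <;> simp [hre, him]
  rw [hw, this, mul_neg_one]

end QuarticJacobi

/-! ### Quartic Gauss sums and the value of χ at primes dividing a -/

section QuarticGauss

open Finset

variable {p : ℕ} [Fact p.Prime] {ρ : GaussianInt →+* ZMod p} {χ : MulChar (ZMod p) GaussianInt}

/-- The product formula `g(χ) g(χ³) = χ(-1) p`, for the image of `χ` in a field. -/
lemma IsQuarticChar.gaussSum_mul_gaussSum_pow_three (hχ : IsQuarticChar ρ χ) (hp4 : p % 4 = 1)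
    {K : Type*} [Field K] (h2 : (2 : K) ≠ 0) (f : GaussianInt →+* K) {ψ : AddChar (ZMod p) K}
    (hψ : ψ.IsPrimitive) :
    gaussSum (χ.ringHomComp f) ψ * gaussSum (χ.ringHomComp f ^ 3) ψ = f (χ (-1)) * p := by
  have hX2 := hχ.ringHomComp_sq_ne_one hp4 f h2
  have h4 : χ.ringHomComp f ^ 4 = 1 := by
    rw [MulChar.ringHomComp_pow, hχ.pow_four_eq_one, MulChar.ringHomComp_one]
  have hinv : (χ.ringHomComp f)⁻¹ = χ.ringHomComp f ^ 3 :=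
    inv_eq_of_mul_eq_one_right (by rw [← pow_succ', h4])
  have h := gaussSum_mul_gaussSum_eq_card (χ := χ.ringHomComp f)
    (by intro h; exact hX2 (by rw [h, one_pow])) hψ
  have h' := mul_gaussSum_inv_eq_gaussSum (χ.ringHomComp f ^ 3) ψ
  rw [hinv, ZMod.card] at h
  have e : (χ.ringHomComp f ^ 3) (-1) = f (χ (-1)) := by
    rw [MulChar.pow_apply' _ three_ne_zero, MulChar.ringHomComp_apply, ← map_pow]
    congr 1
    have : χ (-1) ^ 2 = 1 := by rw [← map_pow]; simp
    linear_combination χ (-1) * this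
  rw [e] at h'
  rw [← h', ← h]; ring

lemma IsQuarticChar.gaussSum_sq_mul_self (hχ : IsQuarticChar ρ χ) (hp4 : p % 4 = 1)
    {K : Type*} [Field K] (h2 : (2 : K) ≠ 0) (f : GaussianInt →+* K) {ψ : AddChar (ZMod p) K}
    (hψ : ψ.IsPrimitive) :
    gaussSum (χ.ringHomComp f ^ 2) ψ ^ 2 = p := by
  have hX2 := hχ.ringHomComp_sq_ne_one hp4 f h2
  have h4 : χ.ringHomComp f ^ 4 = 1 := by
    rw [MulChar.ringHomComp_pow, hχ.pow_four_eq_one, MulChar.ringHomComp_one]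
  have hinv : (χ.ringHomComp f ^ 2)⁻¹ = χ.ringHomComp f ^ 2 :=
    inv_eq_of_mul_eq_one_right (by rw [← pow_add, h4])
  have h := gaussSum_mul_gaussSum_eq_card hX2 hψ
  have h' := mul_gaussSum_inv_eq_gaussSum (χ.ringHomComp f ^ 2) ψ
  rw [hinv, ZMod.card] at h
  have e : (χ.ringHomComp f ^ 2) (-1) = 1 := by
    rw [MulChar.pow_apply' _ two_ne_zero, ← map_pow]; simp
  rw [e, one_mul] at h'
  rw [← h, h', sq]

/-- Multiplying g(χ)g(χ²) = J g(χ³) by g(χ) gives g(χ)² g(χ²) = χ(-1) p J. Square, use g(χ²)² = p,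
and cancel p. -/
lemma IsQuarticChar.gaussSum_pow_four (hχ : IsQuarticChar ρ χ) (hp4 : p % 4 = 1)
    {K : Type*} [Field K] (h2 : (2 : K) ≠ 0) (hpK : (p : K) ≠ 0) (f : GaussianInt →+* K)
    {ψ : AddChar (ZMod p) K} (hψ : ψ.IsPrimitive) :
    gaussSum (χ.ringHomComp f) ψ ^ 4 = p * f (jacobiSum χ (χ ^ 2)) ^ 2 := by
  have hX2 := hχ.ringHomComp_sq_ne_one hp4 f h2
  have h4 : χ.ringHomComp f ^ 4 = 1 := by
    rw [MulChar.ringHomComp_pow, hχ.pow_four_eq_one, MulChar.ringHomComp_one]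
  have hJ := jacobiSum_mul_nontrivial (χ := χ.ringHomComp f) (φ := χ.ringHomComp f ^ 2)
    (by
      intro h; apply hX2
      have h3 : χ.ringHomComp f ^ 3 = 1 := by rw [← h, ← pow_succ']
      rw [pow_succ, h3, one_mul] at h4
      rw [h4, one_pow]) ψ
  rw [← pow_succ', MulChar.ringHomComp_pow χ f 2, jacobiSum_ringHomComp] at hJ
  have h13 := hχ.gaussSum_mul_gaussSum_pow_three hp4 h2 f hψ
  have h22 := hχ.gaussSum_sq_mul_self hp4 h2 f hψ
  rw [MulChar.ringHomComp_pow χ f 2] at h22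
  have he : f (χ (-1)) ^ 2 = 1 := by rw [← map_pow, ← map_pow]; simp
  apply mul_left_cancel₀ hpK
  simp only [Nat.reduceAdd] at hJ
  generalize gaussSum (χ.ringHomComp f) ψ = g at *
  generalize gaussSum (χ.ringHomComp f ^ 3) ψ = g3 at *
  generalize gaussSum ((χ ^ 2).ringHomComp f) ψ = g2 at *
  generalize f (jacobiSum χ (χ ^ 2)) = j at *
  have h1 : f (χ (-1)) * p * j = g ^ 2 * g2 := by
    linear_combination g * hJ - j * h13
  linear_combination -g ^ 4 * h22 - (f (χ (-1)) * p * j + g ^ 2 * g2) * h1 + p ^ 2 * j ^ 2 * he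

/-- Frobenius turns g(χ)^q into the Gauss sum of χ^q for ψ shifted by q; undoing the shift costs the
factor χ(q)^q. -/
lemma IsQuarticChar.mul_gaussSum_pow (hχ : IsQuarticChar ρ χ)
    {K : Type*} [Field K] {q : ℕ} [Fact q.Prime] [CharP K q] (hqp : (q : ZMod p) ≠ 0)
    (f : GaussianInt →+* K) (ψ : AddChar (ZMod p) K) :
    f (χ q) ^ q * gaussSum (χ.ringHomComp f) ψ ^ q = gaussSum (χ.ringHomComp f ^ (q % 4)) ψ := by
  have h4 : χ.ringHomComp f ^ 4 = 1 := by
    rw [MulChar.ringHomComp_pow, hχ.pow_four_eq_one, MulChar.ringHomComp_one]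
  have h := gaussSum_mulShift (χ.ringHomComp f ^ q) ψ (Units.mk0 _ hqp)
  rw [Units.val_mk0, ← AddChar.pow_mulShift, ← gaussSum_frob,
    MulChar.pow_apply' _ (Fact.out : q.Prime).ne_zero, MulChar.ringHomComp_apply] at h
  rw [h]
  congr 1
  conv_lhs => rw [← Nat.mod_add_div q 4, pow_add, pow_mul, h4, one_pow, mul_one]

/-- For a prime `q ≠ p` there is a field of characteristic `q` with a square root of `-1` and a
primitive additive character of `ZMod p`. -/
lemma exists_field_primitive_addChar {q : ℕ} [Fact q.Prime] (hqp : q ≠ p) :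
    ∃ (K : Type) (_ : Field K) (_ : CharP K q) (_ : GaussianInt →+* K) (ψ : AddChar (ZMod p) K),
      ψ.IsPrimitive := by
  let F := AlgebraicClosure (ZMod q)
  have : CharP F q := charP_of_injective_algebraMap (algebraMap (ZMod q) F).injective q
  obtain ⟨i, hi⟩ := IsAlgClosed.exists_pow_nat_eq (-1 : F) two_pos
  let ψ := AddChar.FiniteField.primitiveChar (ZMod p) F (by
    rw [ZMod.ringChar_zmod_n, ringChar.eq F q]; exact hqp)
  refine ⟨CyclotomicField ψ.n F, inferInstance, ?_, ?_, ψ.char, ψ.prim⟩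
  · exact charP_of_injective_algebraMap (algebraMap F (CyclotomicField ψ.n F)).injective q
  · exact (algebraMap F (CyclotomicField ψ.n F)).comp
      (Zsqrtd.lift ⟨i, by rw [← sq, hi]; simp⟩)

lemma IsQuarticChar.apply_prime_of_dvd_re (hχ : IsQuarticChar ρ χ) (hp4 : p % 4 = 1) {a b : ℤ}
    (hnorm : Zsqrtd.norm (⟨a, b⟩ : GaussianInt) = p)
    (hρ : ∀ z, ρ z = 0 ↔ (⟨a, b⟩ : GaussianInt) ∣ z) (hprimary : IsPrimary ⟨a, b⟩)
    {q : ℕ} [Fact q.Prime] (hq2 : q ≠ 2) (hqa : (q : ℤ) ∣ a) :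
    (q % 4 = 1 → χ q = (-1) ^ ((q - 1) / 4)) ∧ (q % 4 = 3 → χ (-q) = (-1) ^ ((q + 1) / 4)) := by
  have hp := (Fact.out : p.Prime)
  have hq := (Fact.out : q.Prime)
  have hab : a ^ 2 + b ^ 2 = (p : ℤ) := by
    rw [← hnorm, Zsqrtd.norm_def]; ring
  have hqb : ¬ (q : ℤ) ∣ b := by
    intro hqb
    have h2 : ((q ^ 2 : ℕ) : ℤ) ∣ p := by
      rw [← hab, Nat.cast_pow]; exact dvd_add (pow_dvd_pow_of_dvd hqa 2) (pow_dvd_pow_of_dvd hqb 2)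
    rw [Int.natCast_dvd_natCast] at h2
    have := (hp.eq_one_or_self_of_dvd q ((dvd_pow_self q two_ne_zero).trans h2)).resolve_left
      hq.one_lt.ne'
    subst this
    have := Nat.le_of_dvd hq.pos h2
    nlinarith [hq.two_le]
  have hqp : q ≠ p := by
    rintro rfl
    apply hqb
    have : (q : ℤ) ∣ b ^ 2 := by
      rw [← Int.dvd_add_right (dvd_pow hqa two_ne_zero), hab]
    exact (Nat.prime_iff_prime_int.1 hq).dvd_of_dvd_pow this
  have hqpZ : (q : ZMod p) ≠ 0 := by
    rw [Ne, ZMod.natCast_eq_zero_iff, Nat.prime_dvd_prime_iff_eq hp hq]; exact hqp.symm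
  obtain ⟨K, _, _, f, ψ, hψ⟩ := exists_field_primitive_addChar (p := p) hqp
  have h2 : (2 : K) ≠ 0 := by
    have : ((2 : ℕ) : K) ≠ 0 := by
      rw [Ne, CharP.cast_eq_zero_iff K q, Nat.prime_dvd_prime_iff_eq hq Nat.prime_two]; exact hq2
    exact_mod_cast this
  have hpK : (p : K) ≠ 0 := by
    rw [Ne, CharP.cast_eq_zero_iff K q, Nat.prime_dvd_prime_iff_eq hq hp]; exact hqp
  have haK : (a : K) = 0 := (CharP.intCast_eq_zero_iff K q a).2 hqa
  have hbK : (b : K) ≠ 0 := fun h => hqb ((CharP.intCast_eq_zero_iff K q b).1 h)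
  have hpb : (p : K) = (b : K) ^ 2 := by
    have := congrArg (Int.cast : ℤ → K) hab
    push_cast at this
    rw [← this, haK]; ring
  have hbq : (b : K) ^ (q - 1) = 1 := by
    have hb : (b : ZMod q) ≠ 0 := by rwa [Ne, ZMod.intCast_zmod_eq_zero_iff_dvd]
    have := congrArg (ZMod.castHom dvd_rfl K) (ZMod.pow_card_sub_one_eq_one hb)
    simpa using this
  have hfπ : f ⟨a, b⟩ = b * f ⟨0, 1⟩ := by
    rw [show (⟨a, b⟩ : GaussianInt) = (a : GaussianInt) + (b : GaussianInt) * ⟨0, 1⟩ by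
      ext <;> simp]
    rw [map_add, map_mul, map_intCast, map_intCast, haK, zero_add]
  have hG4 := hχ.gaussSum_pow_four hp4 h2 hpK f hψ
  have h13 := hχ.gaussSum_mul_gaussSum_pow_three hp4 h2 f hψ
  have hfrob := hχ.mul_gaussSum_pow hqpZ f ψ
  rw [hχ.jacobiSum_eq hp4 hnorm hρ hprimary, map_neg, hfπ, hpb] at hG4
  have hI := GaussianInt.ringHom_I_sq f
  replace hG4 : gaussSum (χ.ringHomComp f) ψ ^ 4 = -(b : K) ^ 4 := by
    linear_combination hG4 + (b : K) ^ 4 * hI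
  have hG0 : gaussSum (χ.ringHomComp f) ψ ≠ 0 := by
    intro h
    rw [h, zero_pow four_ne_zero, zero_eq_neg] at hG4
    exact pow_ne_zero 4 hbK hG4
  have hfq4 : f (χ q) ^ 4 = 1 := by rw [← map_pow, hχ.pow_four _ hqpZ, map_one]
  have hsign (k : ℕ) : ((-1 : GaussianInt) ^ k) ^ 4 = 1 := by
    rw [← pow_mul, mul_comm, pow_mul]; norm_num
  have hfq : f (χ q) ^ q = f (χ q) ^ (q % 4) := by
    conv_lhs =>
      arg 2
      rw [← Nat.mod_add_div q 4]
    rw [pow_add, pow_mul, hfq4, one_pow, mul_one]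
  rw [hfq] at hfrob
  have hsq (k : ℕ) : ((-1 : K) ^ k) * (-1) ^ k = 1 := by rw [← mul_pow]; norm_num
  constructor
  · intro hq1
    refine GaussianInt.eq_of_ringHom_eq h2 f (hχ.pow_four _ hqpZ) (hsign _) ?_
    rw [hq1, pow_one, pow_one] at hfrob
    obtain ⟨k, hk⟩ : ∃ k, q = 4 * k + 1 := ⟨q / 4, by omega⟩
    have hk' : (q - 1) / 4 = k := by omega
    -- From g⁴ = -b⁴ and b^(q-1) = 1 (Fermat), g^q = (-1)^k g; Frobenius says χ(q) g^q = g.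
    have hGq : gaussSum (χ.ringHomComp f) ψ ^ q = (-1) ^ k * gaussSum (χ.ringHomComp f) ψ := by
      rw [show q - 1 = 4 * k by omega] at hbq
      rw [hk, pow_succ, pow_mul, hG4, neg_pow, ← pow_mul, hbq, mul_one]
    rw [hGq] at hfrob
    rw [hk', map_pow, map_neg, map_one]
    apply mul_right_cancel₀ hG0
    linear_combination (-1) ^ k * hfrob - f (χ q) * gaussSum (χ.ringHomComp f) ψ * hsq k
  · intro hq3
    refine GaussianInt.eq_of_ringHom_eq h2 f (hχ.pow_four _ (neg_ne_zero.2 hqpZ)) (hsign _) ?_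
    rw [hq3] at hfrob
    obtain ⟨k, hk⟩ : ∃ k, q + 1 = 4 * k := ⟨(q + 1) / 4, by omega⟩
    have hk' : (q + 1) / 4 = k := by omega
    -- Here Frobenius gives χ(q)³ g^q = g(χ³). Multiplying by g and using g(χ)g(χ³) = χ(-1)b²
    -- determines χ(-1)χ(q).
    have hGq : gaussSum (χ.ringHomComp f) ψ ^ (q + 1) = (-1) ^ k * b ^ 2 := by
      rw [hk, pow_mul, hG4, neg_pow, ← pow_mul, ← hk, show q + 1 = q - 1 + 2 by omega, pow_add, hbq,
        one_mul]
    rw [hk', map_pow, map_neg f, map_one f, neg_eq_neg_one_mul (q : ZMod p), map_mul, map_mul]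
    apply mul_right_cancel₀ (pow_ne_zero 2 hbK)
    rw [hpb] at h13
    rw [pow_succ] at hGq
    linear_combination -f (χ q) * h13 + f (χ q) * gaussSum (χ.ringHomComp f) ψ * (-hfrob)
      + f (χ q) ^ 4 * hGq + (-1) ^ k * b ^ 2 * hfq4

end QuarticGauss

lemma IsPrimary.re_im {a b : ℤ} (h : IsPrimary ⟨a, b⟩) : b % 2 = 0 ∧ (a + b) % 4 = 1 := by
  obtain ⟨⟨x, y⟩, h⟩ := h
  have h1 := congrArg Zsqrtd.re h
  have h2 := congrArg Zsqrtd.im h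
  simp at h1 h2
  omega

/-! ### Evaluation of χ(2a) -/

section QuarticValues

open Finset

variable {p : ℕ} [Fact p.Prime] {ρ : GaussianInt →+* ZMod p} {χ : MulChar (ZMod p) GaussianInt}

/-- For `n ≡ 1 mod 4` dividing `a`, the quartic character attached to the primary prime `a + bi`
takes the value `(-1) ^ ((n - 1) / 4)` at `n`. -/
lemma IsQuarticChar.apply_of_dvd_re (hχ : IsQuarticChar ρ χ) (hp4 : p % 4 = 1) {a b : ℤ}
    (hnorm : Zsqrtd.norm (⟨a, b⟩ : GaussianInt) = p)
    (hρ : ∀ z, ρ z = 0 ↔ (⟨a, b⟩ : GaussianInt) ∣ z) (hprimary : IsPrimary ⟨a, b⟩)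
    {n : ℤ} (hn4 : n % 4 = 1) (hn : n ∣ a) :
    (n % 8 = 1 ∧ χ n = 1) ∨ (n % 8 = 5 ∧ χ n = -1) := by
  have ha : ¬ 2 ∣ a := by have := hprimary.re_im; omega
  -- Induct on prime factors, with a sign ε making εd ≡ 1 mod 4; the dichotomy mod 8 is
  -- multiplicative since 5·5 ≡ 1.
  have key (d : ℕ) : (d : ℤ) ∣ a → ∃ ε : ℤ, (ε = 1 ∨ ε = -1) ∧
      (((ε * d) % 8 = 1 ∧ χ (ε * d : ℤ) = 1) ∨ ((ε * d) % 8 = 5 ∧ χ (ε * d : ℤ) = -1)) := by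
    induction d using induction_on_primes with
    | zero =>
      intro h
      simp only [Nat.cast_zero, zero_dvd_iff] at h
      simp [h] at ha
    | one => intro _; exact ⟨1, Or.inl rfl, by simp⟩
    | prime_mul q d hq ih =>
      intro h
      rw [Nat.cast_mul] at h
      have hqa : (q : ℤ) ∣ a := (dvd_mul_right _ _).trans h
      obtain ⟨ε, hε, ihd⟩ := ih ((dvd_mul_left _ _).trans h)
      have : Fact q.Prime := ⟨hq⟩
      have hq2 : q ≠ 2 := by rintro rfl; exact ha hqa
      have hodd := hq.eq_two_or_odd.resolve_left hq2
      obtain ⟨h1, h3⟩ := hχ.apply_prime_of_dvd_re hp4 hnorm hρ hprimary hq2 hqa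
      have hP : ∃ ε' : ℤ, (ε' = 1 ∨ ε' = -1) ∧
          (((ε' * q) % 8 = 1 ∧ χ (ε' * q : ℤ) = 1) ∨
            ((ε' * q) % 8 = 5 ∧ χ (ε' * q : ℤ) = -1)) := by
        rcases (by omega : q % 8 = 1 ∨ q % 8 = 5 ∨ q % 8 = 3 ∨ q % 8 = 7) with hq8 | hq8 | hq8 | hq8
        · refine ⟨1, Or.inl rfl, Or.inl ⟨by omega, ?_⟩⟩
          push_cast
          rw [one_mul, h1 (by omega), Even.neg_one_pow (by rw [Nat.even_iff]; omega)]
        · refine ⟨1, Or.inl rfl, Or.inr ⟨by omega, ?_⟩⟩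
          push_cast
          rw [one_mul, h1 (by omega), Odd.neg_one_pow (by rw [Nat.odd_iff]; omega)]
        · refine ⟨-1, Or.inr rfl, Or.inr ⟨by omega, ?_⟩⟩
          push_cast
          rw [neg_one_mul, h3 (by omega), Odd.neg_one_pow (by rw [Nat.odd_iff]; omega)]
        · refine ⟨-1, Or.inr rfl, Or.inl ⟨by omega, ?_⟩⟩
          push_cast
          rw [neg_one_mul, h3 (by omega), Even.neg_one_pow (by rw [Nat.even_iff]; omega)]
      obtain ⟨ε', hε', ihq⟩ := hP
      refine ⟨ε' * ε, by rcases hε with rfl | rfl <;> rcases hε' with rfl | rfl <;> simp, ?_⟩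
      rw [show ε' * ε * ((q * d : ℕ) : ℤ) = (ε' * q) * (ε * d) by push_cast; ring, Int.cast_mul,
        map_mul, Int.mul_emod]
      rcases ihd with ⟨hd, hd'⟩ | ⟨hd, hd'⟩ <;> rcases ihq with ⟨hq, hq'⟩ | ⟨hq, hq'⟩ <;>
        rw [hd, hd', hq, hq'] <;> norm_num
  obtain ⟨ε, hε, h⟩ := key n.natAbs (by rwa [Int.natAbs_dvd])
  have : ε * (n.natAbs : ℤ) = n := by
    rcases hε with rfl | rfl <;> omega
  rwa [this] at h

lemma legendreSym_eq_jacobiSym_natAbs (hp4 : p % 4 = 1) {n : ℤ} (hn : n % 2 = 1) :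
    legendreSym p n = jacobiSym p n.natAbs := by
  have hp2 : p ≠ 2 := by omega
  have hodd : Odd n.natAbs := by rw [Nat.odd_iff]; omega
  rw [jacobiSym.quadratic_reciprocity_one_mod_four hp4 hodd, jacobiSym.legendreSym.to_jacobiSym]
  rcases Int.natAbs_eq n with h | h
  · rw [← h]
  · conv_lhs => rw [h]
    rw [jacobiSym.neg _ (by rw [Nat.odd_iff]; omega), ZMod.χ₄_nat_one_mod_four hp4, one_mul]

/-- Since 2p = (a+b)² + (a-b)², 2p is a square modulo a + b. So (p/|a+b|) = (2/|a+b|), which depends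
on a + b mod 8. -/
lemma legendreSym_re_add_im (hp4 : p % 4 = 1) {a b : ℤ} (hab : a ^ 2 + b ^ 2 = (p : ℤ))
    (h4 : (a + b) % 4 = 1) (h0 : ((a + b : ℤ) : ZMod p) ≠ 0) :
    ((a + b) % 8 = 1 ∧ legendreSym p (a + b) = 1) ∨
      ((a + b) % 8 = 5 ∧ legendreSym p (a + b) = -1) := by
  have hodd : Odd (a + b).natAbs := by rw [Nat.odd_iff]; omega
  have hrec := legendreSym_eq_jacobiSym_natAbs (p := p) hp4 (n := a + b) (by omega)
  have hne : legendreSym p (a + b) ≠ 0 := by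
    rw [Ne, legendreSym.eq_zero_iff]; exact h0
  have h2p : jacobiSym 2 (a + b).natAbs * jacobiSym p (a + b).natAbs =
      jacobiSym (a - b) (a + b).natAbs ^ 2 := by
    rw [← jacobiSym.mul_left, ← jacobiSym.pow_left]
    apply jacobiSym.mod_left'
    refine (Int.modEq_iff_dvd.2 (Int.natAbs_dvd.2 ⟨-(a + b), ?_⟩) : _ ≡ _ [ZMOD _])
    rw [← hab]; ring
  rw [hrec] at hne ⊢
  rw [jacobiSym.at_two hodd, ZMod.χ₈_nat_eq_if_mod_eight] at h2p
  have htri := jacobiSym.trichotomy (a - b) (a + b).natAbs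
  have htri' := jacobiSym.trichotomy p (a + b).natAbs
  have h8 : (a + b) % 8 = 1 ∨ (a + b) % 8 = 5 := by omega
  have hmod : ¬ (a + b).natAbs % 2 = 0 := by omega
  rw [if_neg hmod] at h2p
  rcases h8 with h8 | h8
  · rw [if_pos (by omega)] at h2p
    refine Or.inl ⟨h8, ?_⟩
    rcases htri with h | h | h <;> rcases htri' with h' | h' | h' <;> simp_all
  · rw [if_neg (by omega)] at h2p
    refine Or.inr ⟨h8, ?_⟩
    rcases htri with h | h | h <;> rcases htri' with h' | h' | h' <;> simp_all

lemma IsQuarticChar.apply_two_mul_re (hχ : IsQuarticChar ρ χ) (hp4 : p % 4 = 1) {a b : ℤ}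
    (hnorm : Zsqrtd.norm (⟨a, b⟩ : GaussianInt) = p)
    (hρ : ∀ z, ρ z = 0 ↔ (⟨a, b⟩ : GaussianInt) ∣ z) (hprimary : IsPrimary ⟨a, b⟩) :
    χ (2 * a) = ((unitI ^ ((a - 1) / 2) : GaussianIntˣ) : GaussianInt) *
        (((-1) ^ ((b ^ 2 + 2 * b) / 8) : GaussianIntˣ) : GaussianInt) := by
  obtain ⟨hb2, hab4⟩ := hprimary.re_im
  have hab : a ^ 2 + b ^ 2 = (p : ℤ) := by
    rw [← hnorm, Zsqrtd.norm_def]; ring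
  have h2 := two_ne_zero_of_mod_four hp4
  have hI := GaussianInt.ringHom_I_sq ρ
  have hπ : (a : ZMod p) + b * ρ ⟨0, 1⟩ = 0 := by
    rw [← (hρ ⟨a, b⟩).2 dvd_rfl, show (⟨a, b⟩ : GaussianInt) =
      (a : GaussianInt) + (b : GaussianInt) * ⟨0, 1⟩ by ext <;> simp]
    rw [map_add, map_mul, map_intCast, map_intCast]
  have hbι : (b : ZMod p) = a * ρ ⟨0, 1⟩ := by
    linear_combination -ρ ⟨0, 1⟩ * hπ + b * hI
  -- the values of `χ` at `-1` and `±a`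
  obtain ⟨ε, hε, hεa⟩ : ∃ ε : ℤ, (ε = 1 ∨ ε = -1) ∧ (ε * a) % 4 = 1 := by
    rcases (by omega : a % 4 = 1 ∨ a % 4 = 3) with h | h
    · exact ⟨1, Or.inl rfl, by omega⟩
    · exact ⟨-1, Or.inr rfl, by omega⟩
  have hχa := hχ.apply_of_dvd_re hp4 hnorm hρ hprimary hεa
    ⟨ε, by rcases hε with rfl | rfl <;> ring⟩
  have ha0 : (a : ZMod p) ≠ 0 := by
    intro h
    rw [Int.cast_mul, h, mul_zero, χ.map_zero] at hχa
    rcases hχa with ⟨-, h⟩ | ⟨-, h⟩ <;> exact absurd h (by decide)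
  have hχa2 : χ a ^ 2 = 1 := by
    have : χ a ^ 2 = χ (ε * a : ℤ) ^ 2 := by
      rw [← map_pow, ← map_pow]
      rcases hε with rfl | rfl <;> simp
    rw [this]
    rcases hχa with ⟨-, h⟩ | ⟨-, h⟩ <;> rw [h] <;> norm_num
  have hneg : χ (-1) = (-1) ^ ((p - 1) / 4) := by
    have := hχ.apply_map hp4 (z := -1) (by norm_num)
    rwa [map_neg, map_one] at this
  -- the value of `χ` at `2`
  have hab0 : ((a + b : ℤ) : ZMod p) ≠ 0 := by
    intro h
    push_cast at h
    have : 2 * (a : ZMod p) ^ 2 * ρ ⟨0, 1⟩ = 0 := by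
      rw [hbι] at h
      linear_combination (a + a * ρ ⟨0, 1⟩) * h - (a : ZMod p) ^ 2 * hI
    have hI0 : ρ ⟨0, 1⟩ ≠ 0 := by intro h; rw [h] at hI; simp at hI
    exact mul_ne_zero (mul_ne_zero h2 (pow_ne_zero 2 ha0)) hI0 this
  have hs := legendreSym_re_add_im hp4 hab hab4 hab0
  have hχ2 : χ 2 * (⟨0, 1⟩ : GaussianInt) ^ ((p - 1) / 4) =
      ((legendreSym p (a + b) : ℤ) : GaussianInt) := by
    -- As b = aι with ι the image of i, (a+b)² = a²(1+ι)² = 2a²ι.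
    have e : 2 * (a : ZMod p) ^ 2 * ρ ⟨0, 1⟩ = ((a + b : ℤ) : ZMod p) ^ 2 := by
      push_cast
      rw [hbι]
      linear_combination -(a : ZMod p) ^ 2 * hI
    have e' := congrArg χ e
    rw [map_mul, map_mul, map_pow, map_pow, hχa2, mul_one, hχ.apply_map hp4 (by decide),
      hχ.sq_apply hp4] at e'
    exact e'
  rw [map_mul]
  have hI4 : (⟨0, 1⟩ : GaussianInt) ^ 4 = 1 := by decide
  have hIm : (⟨0, 1⟩ : GaussianInt) ^ ((p - 1) / 4) = ⟨0, 1⟩ ^ (((p - 1) / 4) % 4) :=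
    pow_eq_pow_mod _ hI4
  have hnm : (-1 : GaussianInt) ^ ((p - 1) / 4) = (-1) ^ (((p - 1) / 4) % 4) :=
    pow_eq_pow_mod _ (by norm_num)
  have hu : unitI ^ ((a - 1) / 2) = unitI ^ (((a - 1) / 2) % 4) :=
    (zpow_eq_zpow_emod' _ (by decide))
  have hn : (-1 : GaussianIntˣ) ^ ((b ^ 2 + 2 * b) / 8) = (-1) ^ (((b ^ 2 + 2 * b) / 8) % 2) :=
    (zpow_eq_zpow_emod' _ (by decide))
  have hχa' : (a % 8 = 1 ∧ χ a = 1) ∨ (a % 8 = 5 ∧ χ a = -1) ∨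
      (a % 8 = 7 ∧ χ a = (-1) ^ (((p - 1) / 4) % 4)) ∨
      (a % 8 = 3 ∧ χ a = -(-1) ^ (((p - 1) / 4) % 4)) := by
    rcases hε with rfl | rfl
    · rw [one_mul] at hχa
      rcases hχa with h | h <;> simp [h]
    · have e : χ a = χ (-1) * χ ((-1 * a : ℤ) : ZMod p) := by
        rw [← map_mul]; simp
      rw [hneg, hnm] at e
      rcases hχa with ⟨h, h'⟩ | ⟨h, h'⟩ <;> rw [h'] at e
      · exact Or.inr (Or.inr (Or.inl ⟨by omega, by rw [e, mul_one]⟩))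
      · exact Or.inr (Or.inr (Or.inr ⟨by omega, by rw [e, mul_neg_one]⟩))
  -- Multiplying by i^((p-1)/4) replaces χ(2) by the Legendre symbol of a + b.
  apply mul_right_cancel₀ (pow_ne_zero ((p - 1) / 4) (by decide : (⟨0, 1⟩ : GaussianInt) ≠ 0))
  rw [mul_right_comm, hχ2, hu, hn, hIm]
  -- The residues of a and b mod 8 determine p and b² + 2b mod 16, hence all exponents that occur.
  obtain ⟨k, r, rfl, hr⟩ : ∃ k r : ℤ, a = 8 * k + r ∧ (r = 1 ∨ r = 3 ∨ r = 5 ∨ r = 7) :=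
    ⟨a / 8, a % 8, by omega, by omega⟩
  obtain ⟨l, s, rfl, hs'⟩ : ∃ l s : ℤ, b = 8 * l + s ∧ (s = 0 ∨ s = 2 ∨ s = 4 ∨ s = 6) :=
    ⟨b / 8, b % 8, by omega, by omega⟩
  have hpe : (p : ℤ) = 16 * (4 * k ^ 2 + k * r + 4 * l ^ 2 + l * s) + (r ^ 2 + s ^ 2) := by
    rw [← hab]; ring
  have hbe : (8 * l + s) ^ 2 + 2 * (8 * l + s) = 16 * (4 * l ^ 2 + l * s + l) + (s ^ 2 + 2 * s) := by
    ring
  rw [hbe]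
  generalize 4 * k ^ 2 + k * r + 4 * l ^ 2 + l * s = T at hpe
  generalize 4 * l ^ 2 + l * s + l = U
  generalize hm : (p - 1) / 4 % 4 = m at *
  generalize hx : (8 * k + r - 1) / 2 % ((4 : ℕ) : ℤ) = x
  generalize hy : (16 * U + (s ^ 2 + 2 * s)) / 8 % ((2 : ℕ) : ℤ) = y
  clear hu hn hIm hnm hneg hχ2 hχa hbι hπ hab0
  rcases hs with ⟨hs, hL⟩ | ⟨hs, hL⟩ <;> rw [hL] <;> clear hL <;>
  rcases hr with rfl | rfl | rfl | rfl <;> rcases hs' with rfl | rfl | rfl | rfl <;>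
  first
  | (exfalso; omega)
  | (rcases hχa' with ⟨h, h'⟩ | ⟨h, h'⟩ | ⟨h, h'⟩ | ⟨h, h'⟩ <;> first
     | (exfalso; omega)
     | (rw [h']
        norm_num at hpe hy hx
        have hm3 : m < 4 := by omega
        have hx3 : 0 ≤ x ∧ x < 4 := by omega
        have hy3 : 0 ≤ y ∧ y < 2 := by omega
        obtain ⟨hx0, hx3⟩ := hx3
        obtain ⟨hy0, hy3⟩ := hy3
        interval_cases m <;> interval_cases x <;> interval_cases y <;> first
        | (exfalso; omega)
        | decide))

end QuarticValues

/-! ### The point count as a sum of Jacobi sums -/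

section CharacterSum

open Finset

variable {p : ℕ} [Fact p.Prime] {ρ : GaussianInt →+* ZMod p} {χ : MulChar (ZMod p) GaussianInt}

/-- The fibre of squaring over u has 1 + (u/K) elements. -/
lemma sum_comp_sq {K R : Type*} [Field K] [Fintype K] [DecidableEq K] [CommRing R]
    (hK : ringChar K ≠ 2) (F : K → R) :
    ∑ x, F (x ^ 2) = ∑ u, (1 + ((quadraticChar K u : ℤ) : R)) * F u := by
  rw [← sum_fiberwise_of_maps_to (g := fun x : K => x ^ 2) (t := univ) (fun _ _ => mem_univ _)]
  refine sum_congr rfl fun u _ => ?_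
  rw [sum_congr rfl (g := fun _ => F u) (by intro x hx; rw [(mem_filter.1 hx).2]), sum_const,
    nsmul_eq_mul]
  congr 1
  have := quadraticChar_card_sqrts hK u
  rw [← Int.cast_natCast, add_comm, ← Int.cast_one, ← Int.cast_add, ← this]
  congr 3
  ext; simp

lemma card_weierstrass_eq {K : Type*} [Field K] [Fintype K] [DecidableEq K]
    (hK : ringChar K ≠ 2) (f : K → K) :
    (Nat.card {P : K × K // P.2 ^ 2 = f P.1} : ℤ) =
      Fintype.card K + ∑ x, quadraticChar K (f x) := by
  have e : {P : K × K // P.2 ^ 2 = f P.1} ≃ Σ x : K, {y : K // y ^ 2 = f x} :=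
    { toFun := fun P => ⟨P.1.1, P.1.2, P.2⟩
      invFun := fun Q => ⟨(Q.1, Q.2.1), Q.2.2⟩
      left_inv := fun _ => rfl
      right_inv := fun _ => rfl }
  rw [Nat.card_congr e, Nat.card_eq_fintype_card, Fintype.card_sigma, Nat.cast_sum]
  have (x : K) : (Fintype.card {y : K // y ^ 2 = f x} : ℤ) = quadraticChar K (f x) + 1 := by
    rw [← quadraticChar_card_sqrts hK]
    simp [Fintype.card_subtype]
  simp only [this, sum_add_distrib]
  simp [add_comm]

lemma sum_mul_sq_apply_sub (χ φ : MulChar (ZMod p) GaussianInt) {t : ZMod p} (ht : t ≠ 0) :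
    ∑ u, φ u * χ (u - t) ^ 2 = φ t * χ t ^ 2 * jacobiSum φ (χ ^ 2) := by
  have hneg : χ (-1) ^ 2 = 1 := by rw [← map_pow]; simp
  rw [← Equiv.sum_comp (Equiv.mulLeft₀ t ht) (fun u => φ u * χ (u - t) ^ 2), jacobiSum, mul_sum]
  refine sum_congr rfl fun v _ => ?_
  change φ (t * v) * χ (t * v - t) ^ 2 = _
  rw [show t * v - t = t * (-1) * (1 - v) by ring, MulChar.pow_apply' _ two_ne_zero]
  simp only [map_mul]
  linear_combination φ t * φ v * χ t ^ 2 * χ (1 - v) ^ 2 * hneg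

/-- As χ² is the quadratic character, the summand is a function of u = x². The weight 1 + χ²(u)
splits the sum into a χ part and a χ³ part, each a Jacobi sum after scaling u by t. -/
lemma IsQuarticChar.sum_quadraticChar (hχ : IsQuarticChar ρ χ) (hp4 : p % 4 = 1)
    {t : ZMod p} (ht : t ≠ 0) :
    ((∑ x : ZMod p, quadraticChar (ZMod p) (x ^ 3 - t * x) : ℤ) : GaussianInt) =
      χ t ^ 3 * jacobiSum χ (χ ^ 2) + χ t * jacobiSum (χ ^ 3) (χ ^ 2) := by
  have h1 := sum_mul_sq_apply_sub χ χ ht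
  have h3 := sum_mul_sq_apply_sub χ (χ ^ 3) ht
  rw [MulChar.pow_apply' _ three_ne_zero] at h3
  have hterm (x : ZMod p) : ((quadraticChar (ZMod p) (x ^ 3 - t * x) : ℤ) : GaussianInt) =
      χ (x ^ 2) * χ (x ^ 2 - t) ^ 2 := by
    rw [← hχ.sq_apply hp4, show x ^ 3 - t * x = x * (x ^ 2 - t) by ring, map_mul, map_pow, mul_pow]
  rw [Int.cast_sum]
  simp only [hterm]
  rw [sum_comp_sq (ringChar_zmod_ne_two hp4) (fun u => χ u * χ (u - t) ^ 2)]
  have hsplit (u : ZMod p) : (1 + ((quadraticChar (ZMod p) u : ℤ) : GaussianInt)) *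
      (χ u * χ (u - t) ^ 2) = χ u * χ (u - t) ^ 2 + (χ ^ 3) u * χ (u - t) ^ 2 := by
    rw [← hχ.sq_apply hp4, MulChar.pow_apply' _ three_ne_zero]; ring
  simp only [hsplit, sum_add_distrib, h1, h3]
  linear_combination χ t * jacobiSum (χ ^ 3) (χ ^ 2) * hχ.pow_four t ht

/-- With J = -π and J̄ = -(2a - π), only the term with 2a survives modulo π. -/
lemma IsQuarticChar.map_neg_sum_quadraticChar (hχ : IsQuarticChar ρ χ) (hp4 : p % 4 = 1) {a b : ℤ}
    (hnorm : Zsqrtd.norm (⟨a, b⟩ : GaussianInt) = p)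
    (hρ : ∀ z, ρ z = 0 ↔ (⟨a, b⟩ : GaussianInt) ∣ z) (hprimary : IsPrimary ⟨a, b⟩)
    {t : ZMod p} (ht : t ≠ 0) :
    ((-∑ x : ZMod p, quadraticChar (ZMod p) (x ^ 3 - t * x) : ℤ) : ZMod p) =
      t ^ ((p - 1) / 4) * (2 * a) := by
  have h := congrArg ρ (hχ.sum_quadraticChar hp4 ht)
  rw [← hχ.star_jacobiSum, hχ.jacobiSum_eq hp4 hnorm hρ hprimary, map_intCast, star_neg,
    show star (⟨a, b⟩ : GaussianInt) = ((2 * a : ℤ) : GaussianInt) - ⟨a, b⟩ by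
      ext <;> simp; ring] at h
  simp only [map_add, map_mul, map_neg, map_sub, map_intCast, (hρ _).2 dvd_rfl,
    hχ.map_apply] at h
  rw [Int.cast_neg, h]
  push_cast
  ring

end CharacterSum

/-! ### Point counts under isomorphism of Weierstrass equations -/

section WeierstrassPoints

open WeierstrassCurve

/-- Over a field, points on an elliptic curve are the solutions of the Weierstrass equation together
with the point at infinity. -/
lemma WeierstrassCurve.natCard_point {K : Type*} [Field K] [Finite K] (W : WeierstrassCurve K)
    (hΔ : W.Δ ≠ 0) :
    Nat.card W.toAffine.Point = Nat.card {P : K × K // W.toAffine.Equation P.1 P.2} + 1 := by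
  have e : W.toAffine.Point ≃ Option {P : K × K // W.toAffine.Equation P.1 P.2} :=
    { toFun := fun P => match P with
        | .zero => none
        | .some x y h => some ⟨(x, y), (W.toAffine.equation_iff_nonsingular_of_Δ_ne_zero hΔ).2 h⟩
      invFun := fun P => match P with
        | none => .zero
        | some P => .some P.1.1 P.1.2
            ((W.toAffine.equation_iff_nonsingular_of_Δ_ne_zero hΔ).1 P.2)
      left_inv := fun P => by cases P <;> rfl
      right_inv := fun P => by cases P <;> rfl }
  rw [Nat.card_congr e, Finite.card_option]

lemma WeierstrassCurve.equation_variableChange_iff {K : Type*} [Field K] (W : WeierstrassCurve K)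
    (C : VariableChange K) (x y : K) :
    (C • W).toAffine.Equation x y ↔
      W.toAffine.Equation (C.u ^ 2 * x + C.r) (C.u ^ 3 * y + C.u ^ 2 * C.s * x + C.t) := by
  rw [Affine.equation_iff', Affine.equation_iff']
  simp only [variableChange_a₁, variableChange_a₂, variableChange_a₃, variableChange_a₄,
    variableChange_a₆]
  have hu : (C.u : K) ≠ 0 := C.u.ne_zero
  rw [← mul_right_inj' (pow_ne_zero 6 hu), mul_zero]
  simp only [Units.val_inv_eq_inv_val]
  field_simp
  constructor <;> intro h <;> linear_combination h

lemma WeierstrassCurve.natCard_equation_variableChange {K : Type*} [Field K]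
    (W : WeierstrassCurve K) (C : VariableChange K) :
    Nat.card {P : K × K // (C • W).toAffine.Equation P.1 P.2} =
      Nat.card {P : K × K // W.toAffine.Equation P.1 P.2} := by
  have hu : (C.u : K) ≠ 0 := C.u.ne_zero
  let e : K × K ≃ K × K :=
    { toFun := fun P => (C.u ^ 2 * P.1 + C.r, C.u ^ 3 * P.2 + C.u ^ 2 * C.s * P.1 + C.t)
      invFun := fun P => ((P.1 - C.r) / C.u ^ 2,
        (P.2 - C.s * (P.1 - C.r) - C.t) / C.u ^ 3)
      left_inv := fun P => by ext <;> field_simp <;> ring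
      right_inv := fun P => by ext <;> field_simp <;> ring }
  exact Nat.card_congr (e.subtypeEquiv fun P => W.equation_variableChange_iff C P.1 P.2)

lemma WeierstrassCurve.natCard_equation_map {K L : Type*} [Field K] [Field L]
    (W : WeierstrassCurve K) (e : K ≃+* L) :
    Nat.card {P : L × L // (W.map (e : K →+* L)).toAffine.Equation P.1 P.2} =
      Nat.card {P : K × K // W.toAffine.Equation P.1 P.2} := by
  refine (Nat.card_congr ((e.toEquiv.prodCongr e.toEquiv).subtypeEquiv fun P => ?_)).symm
  exact (Affine.map_equation W (f := (e : K →+* L)) e.injective P.1 P.2).symm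

end WeierstrassPoints

/-! ### Good reduction and independence of the integral equation -/

section Padic

open WeierstrassCurve

variable {p : ℕ} [Fact p.Prime]

/-- Two integral Weierstrass equations over `ℤ_p` with unit discriminant, `p ≥ 5`, that are
isomorphic over `ℚ_p` are isomorphic over `ℤ_p`. -/
lemma PadicInt.exists_variableChange_of_isUnit_Δ (hp : 5 ≤ p) (W W' : WeierstrassCurve ℤ_[p])
    (hW : IsUnit W.Δ) (hW' : IsUnit W'.Δ) (C : VariableChange ℚ_[p])
    (hC : C • (W.map (algebraMap ℤ_[p] ℚ_[p])) = W'.map (algebraMap ℤ_[p] ℚ_[p])) :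
    ∃ C' : VariableChange ℤ_[p], C' • W = W' := by
  have hpp := (Fact.out : p.Prime)
  have hunit (n : ℕ) (h0 : 0 < n) (hn : n < p) : ‖(n : ℚ_[p])‖ = 1 := by
    have : ¬ p ∣ n := fun h => by have := Nat.le_of_dvd h0 h; omega
    rw [Padic.norm_natCast_eq_one_iff]
    exact (hpp.coprime_iff_not_dvd.2 this)
  have h2 : ‖(2 : ℚ_[p])‖ = 1 := by exact_mod_cast hunit 2 (by norm_num) (by omega)
  have h3 : ‖(3 : ℚ_[p])‖ = 1 := by exact_mod_cast hunit 3 (by norm_num) (by omega)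
  obtain ⟨u, r, s, t⟩ := C
  have e1 := congrArg WeierstrassCurve.a₁ hC
  have e2 := congrArg WeierstrassCurve.a₂ hC
  have e3 := congrArg WeierstrassCurve.a₃ hC
  have eΔ := congrArg WeierstrassCurve.Δ hC
  rw [variableChange_Δ, map_Δ, map_Δ] at eΔ
  simp only [variableChange_a₁, variableChange_a₂, variableChange_a₃, map_a₁, map_a₂, map_a₃] at e1 e2 e3
  have hu0 : (u : ℚ_[p]) ≠ 0 := u.ne_zero
  have hu : ‖(u : ℚ_[p])‖ = 1 := by
    have h := congrArg norm eΔ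
    have n1 : ‖algebraMap ℤ_[p] ℚ_[p] W.Δ‖ = 1 := PadicInt.isUnit_iff.1 hW
    have n2 : ‖algebraMap ℤ_[p] ℚ_[p] W'.Δ‖ = 1 := PadicInt.isUnit_iff.1 hW'
    rw [norm_mul, n1, n2, mul_one, norm_pow] at h
    have := (pow_eq_one_iff_of_nonneg (norm_nonneg _) (by norm_num)).1 h
    simpa using this
  have hint {x : ℚ_[p]} (y : ℤ_[p]) (h : x = algebraMap ℤ_[p] ℚ_[p] y) : ‖x‖ ≤ 1 := by
    rw [h]; exact y.norm_le_one
  let u' : ℤ_[p]ˣ := PadicInt.mkUnits hu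
  have hu' : algebraMap ℤ_[p] ℚ_[p] u' = u := rfl
  simp only [Units.val_inv_eq_inv_val] at e1 e2 e3
  field_simp at e1 e2 e3
  -- The transformation rules for a₁, a₂, a₃ make 2s, 3r, 2t integral in turn, and 2, 3 are units
  -- since p ≥ 5.
  have hs : ‖s‖ ≤ 1 := by
    have := hint (x := 2 * s) (u' * W'.a₁ - W.a₁) (by
      rw [map_sub, map_mul, hu']; linear_combination e1)
    rwa [norm_mul, h2, one_mul] at this
  let s' : ℤ_[p] := ⟨s, hs⟩
  have hs' : algebraMap ℤ_[p] ℚ_[p] s' = s := rfl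
  have hr : ‖r‖ ≤ 1 := by
    have := hint (x := 3 * r) (u' ^ 2 * W'.a₂ - W.a₂ + s' * W.a₁ + s' ^ 2) (by
      simp only [map_add, map_sub, map_mul, map_pow, hu', hs']; linear_combination e2)
    rwa [norm_mul, h3, one_mul] at this
  let r' : ℤ_[p] := ⟨r, hr⟩
  have hr' : algebraMap ℤ_[p] ℚ_[p] r' = r := rfl
  have ht : ‖t‖ ≤ 1 := by
    have := hint (x := 2 * t) (u' ^ 3 * W'.a₃ - W.a₃ - r' * W.a₁) (by
      simp only [map_sub, map_mul, map_pow, hu', hr']; linear_combination e3)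
    rwa [norm_mul, h2, one_mul] at this
  refine ⟨⟨u', r', s', ⟨t, ht⟩⟩, ?_⟩
  apply WeierstrassCurve.map_injective (f := algebraMap ℤ_[p] ℚ_[p]) (IsFractionRing.injective _ _)
  dsimp only
  rw [← map_variableChange, ← hC]
  congr 1
  ext <;> rfl

lemma PadicInt.valuation_maximalIdeal_eq_one_iff (x : ℤ_[p]) :
    IsDedekindDomain.HeightOneSpectrum.valuation ℚ_[p]
      (IsDiscreteValuationRing.maximalIdeal ℤ_[p]) (algebraMap ℤ_[p] ℚ_[p] x) = 1 ↔ IsUnit x := by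
  have h := IsDedekindDomain.HeightOneSpectrum.valuation_lt_one_iff_mem (K := ℚ_[p])
    (IsDiscreteValuationRing.maximalIdeal ℤ_[p]) x
  have hle := IsDedekindDomain.HeightOneSpectrum.valuation_le_one (K := ℚ_[p])
    (IsDiscreteValuationRing.maximalIdeal ℤ_[p]) x
  have h' : x ∈ (IsDiscreteValuationRing.maximalIdeal ℤ_[p]).asIdeal ↔ ¬ IsUnit x :=
    IsLocalRing.mem_maximalIdeal x
  rw [← not_iff_not, ← h', ← h, lt_iff_le_and_ne]
  exact ⟨fun h1 => ⟨hle, h1⟩, fun h1 => h1.2⟩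

/-- A minimal equation maximizes the valuation of Δ among integral ones, and `W` already attains the
upper bound 1. -/
lemma PadicInt.hasGoodReduction_minimal (W : WeierstrassCurve ℤ_[p]) (hW : IsUnit W.Δ) :
    ((W.map (algebraMap ℤ_[p] ℚ_[p])).minimal ℤ_[p]).HasGoodReduction ℤ_[p] := by
  generalize hE : W.map (algebraMap ℤ_[p] ℚ_[p]) = E
  obtain ⟨C, hC⟩ : ∃ C : VariableChange ℚ_[p], E.minimal ℤ_[p] = C • E := ⟨_, rfl⟩
  have hEint : IsIntegral ℤ_[p] E := ⟨W, hE.symm⟩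
  have hback : C⁻¹ • E.minimal ℤ_[p] = E := by rw [hC, inv_smul_smul]
  have hmax := (inferInstance : IsMinimal ℤ_[p] (E.minimal ℤ_[p])).val_Δ_maximal
  have hle := (le_total _ _).elim (hmax.2 (j := C⁻¹) (by simpa only [hback] using hEint)) id
  simp only [hback, one_smul] at hle
  have hE1 : (valuation_Δ_aux ℤ_[p] E : WithZero (Multiplicative ℤ)) = 1 := by
    rw [valuation_Δ_aux_eq_of_isIntegral, ← hE, map_Δ, valuation_maximalIdeal_eq_one_iff]
    exact hW
  refine ⟨?_⟩
  rw [← valuation_Δ_aux_eq_of_isIntegral]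
  exact le_antisymm (valuation_Δ_aux ℤ_[p] (E.minimal ℤ_[p])).2
    (hE1.symm.trans_le (Subtype.coe_le_coe.2 hle))

/-- The Fourier coefficient at `p ≥ 5` computed from any integral equation with unit discriminant. -/
lemma ellipticFourierCoeff_eq (hp : 5 ≤ p) (E : WeierstrassCurve ℚ) (W : WeierstrassCurve ℤ_[p])
    (hW : IsUnit W.Δ) (hE : E.baseChange ℚ_[p] = W.map (algebraMap ℤ_[p] ℚ_[p])) :
    ellipticFourierCoeff E p = p -
      Nat.card {P : ZMod p × ZMod p // (W.map PadicInt.toZMod).toAffine.Equation P.1 P.2} := by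
  have hgood := PadicInt.hasGoodReduction_minimal W hW
  rw [ellipticFourierCoeff, hE, localPolynomial, if_pos hgood]
  set E' := (W.map (algebraMap ℤ_[p] ℚ_[p])).minimal ℤ_[p] with hE'
  have hmap : (integralModel ℤ_[p] E').map (algebraMap ℤ_[p] ℚ_[p]) = E' :=
    baseChange_integralModel_eq ℤ_[p] E'
  have hunit : IsUnit (integralModel ℤ_[p] E').Δ := by
    rw [← PadicInt.valuation_maximalIdeal_eq_one_iff, integralModel_Δ_eq]
    exact hgood.goodReduction
  obtain ⟨C, hC⟩ := PadicInt.exists_variableChange_of_isUnit_Δ hp W _ hW hunit _ hmap.symm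
  have hcardκ : Nat.card (IsLocalRing.ResidueField ℤ_[p]) = p := by
    rw [Nat.card_congr PadicInt.residueField.toEquiv, Nat.card_zmod]
  have : Finite (IsLocalRing.ResidueField ℤ_[p]) := .of_equiv _ PadicInt.residueField.toEquiv.symm
  -- The `+ 1` is the point at infinity; it cancels the 1 in p + 1 - #E.
  have hcard : Nat.card (E'.reduction ℤ_[p]).toAffine.Point = Nat.card
      {P : ZMod p × ZMod p // (W.map PadicInt.toZMod).toAffine.Equation P.1 P.2} + 1 := by
    rw [natCard_point]
    · rw [reduction, ← hC, ← map_variableChange, natCard_equation_variableChange,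
        ← natCard_equation_map _ PadicInt.residueField, map_map,
        PadicInt.toZMod_eq_residueField_comp_residue]
      rfl
    · rw [reduction, map_Δ]
      exact (hunit.map (IsLocalRing.residue ℤ_[p])).ne_zero
  rw [hcard, hcardκ]
  simp [Polynomial.coeff_one]

end Padic

/-! ### The Fourier coefficient and the symbol of t as character expressions -/

section FourierCoefficient

variable {p : ℕ} [Fact p.Prime]

lemma quarticSymbolRat_eq {ρ : GaussianInt →+* ZMod p} {χ : MulChar (ZMod p) GaussianInt}
    (hχ : IsQuarticChar ρ χ) (hp4 : p % 4 = 1) {π : GaussianInt}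
    (hnorm : π.norm = p) (hρ : ∀ z, ρ z = 0 ↔ π ∣ z) {t : ℚ} (hden : (t.den : ZMod p) ≠ 0) :
    quarticSymbolRat t π = χ ((t.num : ZMod p) / t.den) := by
  rw [quarticSymbolRat, quarticSymbol_eq hχ hp4 hnorm hρ, quarticSymbol_eq hχ hp4 hnorm hρ,
    map_intCast, map_natCast, ← hχ.pow_three_apply]
  have e : χ (t.num : ZMod p) = χ ((t.num : ZMod p) / t.den) * χ t.den := by
    rw [← map_mul, div_mul_cancel₀ _ hden]
  rw [e]
  linear_combination χ ((t.num : ZMod p) / t.den) * hχ.pow_four _ hden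

/-- The equation has discriminant 64t³, a unit at p, so it can itself serve as the integral
equation. -/
lemma ellipticFourierCoeff_curveE (hp4 : p % 4 = 1) {t : ℚ} (hnum : (t.num : ZMod p) ≠ 0)
    (hden : (t.den : ZMod p) ≠ 0) :
    ellipticFourierCoeff (curveE t) p = -∑ x : ZMod p,
      quadraticChar (ZMod p) (x ^ 3 - (t.num : ZMod p) / t.den * x) := by
  have hpp := (Fact.out : p.Prime)
  have hp5 : 5 ≤ p := by
    have := hpp.two_le; omega
  have hn : ‖(t.num : ℚ_[p])‖ = 1 := by
    rw [Padic.norm_intCast_eq_one_iff, isCoprime_comm, (Nat.prime_iff_prime_int.1 hpp).coprime_iff_not_dvd,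
      ← ZMod.intCast_zmod_eq_zero_iff_dvd]
    exact hnum
  have hd : ‖(t.den : ℚ_[p])‖ = 1 := by
    rw [Padic.norm_natCast_eq_one_iff, hpp.coprime_iff_not_dvd, ← ZMod.natCast_eq_zero_iff]
    exact hden
  have htq : (t : ℚ_[p]) = t.num / t.den := by
    conv_lhs => rw [← Rat.num_div_den t]
    push_cast; rfl
  have ht : ‖(t : ℚ_[p])‖ = 1 := by rw [htq, norm_div, hn, hd, div_one]
  let t₀ : ℤ_[p] := ⟨t, ht.le⟩
  have ht₀ : IsUnit t₀ := PadicInt.isUnit_iff.2 ht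
  have hd0 : (t.den : ℚ_[p]) ≠ 0 := by exact_mod_cast t.den_ne_zero
  have hmul : t₀ * t.den = t.num := by
    apply Subtype.ext
    push_cast
    change (t : ℚ_[p]) * t.den = t.num
    rw [htq, div_mul_cancel₀ _ hd0]
  have hbar : PadicInt.toZMod t₀ = (t.num : ZMod p) / t.den := by
    rw [eq_div_iff hden, ← map_natCast (PadicInt.toZMod (p := p)), ← map_mul, hmul, map_intCast]
  have h2 : IsUnit (2 : ℤ_[p]) := by
    rw [PadicInt.isUnit_iff]
    have : ‖((2 : ℕ) : ℚ_[p])‖ = 1 := by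
      rw [Padic.norm_natCast_eq_one_iff, hpp.coprime_iff_not_dvd]
      intro h
      have := Nat.le_of_dvd two_pos h
      omega
    exact_mod_cast this
  let W : WeierstrassCurve ℤ_[p] := ⟨0, 0, 0, -t₀, 0⟩
  have hΔ : IsUnit W.Δ := by
    have : W.Δ = 2 ^ 6 * t₀ ^ 3 := by
      simp only [W, WeierstrassCurve.Δ, WeierstrassCurve.b₂, WeierstrassCurve.b₄,
        WeierstrassCurve.b₆, WeierstrassCurve.b₈]
      ring
    rw [this]
    exact (h2.pow 6).mul (ht₀.pow 3)
  have hE : (curveE t).baseChange ℚ_[p] = W.map (algebraMap ℤ_[p] ℚ_[p]) := by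
    ext <;> simp [WeierstrassCurve.baseChange, curveE, W]
    rfl
  rw [ellipticFourierCoeff_eq hp5 _ W hΔ hE]
  have hcard := card_weierstrass_eq (K := ZMod p) (ringChar_zmod_ne_two hp4)
    (fun x => x ^ 3 - (t.num : ZMod p) / t.den * x)
  have hequiv : Nat.card
      {P : ZMod p × ZMod p // (W.map PadicInt.toZMod).toAffine.Equation P.1 P.2} =
      Nat.card {P : ZMod p × ZMod p // P.2 ^ 2 = P.1 ^ 3 - (t.num : ZMod p) / t.den * P.1} := by
    refine Nat.card_congr (Equiv.subtypeEquivRight fun P => ?_)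
    rw [WeierstrassCurve.Affine.equation_iff]
    simp [W, hbar, sub_eq_add_neg]
  rw [hequiv, hcard, ZMod.card]
  ring

end FourierCoefficient

/-- The right side is a unit while the symbol is 0 at multiples of a + bi, so the equality includes
non-divisibility of a_p. -/
theorem proposition4p3 (t : ℚ) (ht : t ≠ 0) (p : ℕ) [Fact p.Prime] (hp4 : p % 4 = 1)
    (hnum : IsCoprime (p : ℤ) t.num) (hden : p.Coprime t.den)
    (a b : ℤ) (hprimary : IsPrimary ⟨a, b⟩) (hirr : Irreducible (⟨a, b⟩ : GaussianInt))
    (hnorm : Zsqrtd.norm (⟨a, b⟩ : GaussianInt) = p) :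
    quarticSymbol (ellipticFourierCoeff (curveE t) p : GaussianInt) ⟨a, b⟩ =
      ((unitI ^ ((a - 1) / 2) : GaussianIntˣ) : GaussianInt) *
        (((-1) ^ ((b ^ 2 + 2 * b) / 8) : GaussianIntˣ) : GaussianInt) *
        quarticSymbolRat t ⟨a, b⟩ ^ ((p - 1) / 4) := by
  have hpp := (Fact.out : p.Prime)
  have hnum' : (t.num : ZMod p) ≠ 0 := by
    rw [Ne, ZMod.intCast_zmod_eq_zero_iff_dvd]
    exact ((Nat.prime_iff_prime_int.1 hpp).coprime_iff_not_dvd).1 hnum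
  have hden' : (t.den : ZMod p) ≠ 0 := by
    rw [Ne, ZMod.natCast_eq_zero_iff]
    exact (hpp.coprime_iff_not_dvd).1 hden
  obtain ⟨ρ, hρ⟩ := GaussianInt.exists_residueHom hirr hnorm
  obtain ⟨χ, hχ⟩ := exists_isQuarticChar hp4 ρ
  rw [quarticSymbol_eq hχ hp4 hnorm hρ, map_intCast, ellipticFourierCoeff_curveE hp4 hnum' hden',
    hχ.map_neg_sum_quadraticChar hp4 hnorm hρ hprimary (div_ne_zero hnum' hden'), map_mul, map_pow,
    hχ.apply_two_mul_re hp4 hnorm hρ hprimary, quarticSymbolRat_eq hχ hp4 hnorm hρ hden', mul_comm]
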